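/- Let $K$ be an algebraically closed field of characteristic $2$. For a homogeneous polynomial $B\in K[x_1,x_2,x_3]$ of degree $4$, let $\mathcal C_B\subset\mathbb P^2_K$ be its critical locus, that is, the closed subscheme defined by $\partial B/\partial x_1=\partial B/\partial x_2=\partial B/\partial x_3=0$. 1. If the set of points $\mathcal C_B(K)$ is finite, then it has at most $7$ elements. 2. For general $B$ (that is, for all $B$ in some nonempty Zariski-open subset of the $15$-dimensional affine space of quartic forms), $\mathcal C_B$ consists of exactly $7$ reduced points: $\mathcal C_B(K)$ has exactly $7$ elements and the scheme $\mathcal C_B$ is reduced. 3. For the Klein quartic $B^0=x_1^3x_2+x_2^3x_3+x_3^3x_1$, the scheme $\mathcal C_{B^0}$ consists of exactly $7$ reduced points, namely the points $(1:\varepsilon:\varepsilon^5)$ with $\varepsilon\in K$, $\varepsilon^7=1$. -/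

import Mathlib

open scoped LinearAlgebra.Projectivization

namespace CharTwoQuartic

variable {K : Type*} [Field K]

/-- The critical locus `{∇B = 0}` in the projective plane, as a set of `K`-points. For a form `B`
the condition does not depend on the chosen representative, see `mk_mem_criticalLocus_iff`. -/
def criticalLocus (B : MvPolynomial (Fin 3) K) : Set (ℙ K (Fin 3 → K)) :=
  {p | ∀ k : Fin 3, MvPolynomial.eval p.rep (MvPolynomial.pderiv k B) = 0}

theorem eval_smul_of_isHomogeneous {F : MvPolynomial (Fin 3) K} {n : ℕ}
    (hF : F.IsHomogeneous n) (c : K) (v : Fin 3 → K) :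
    MvPolynomial.eval (c • v) F = c ^ n * MvPolynomial.eval v F := by
  rw [MvPolynomial.eval_eq, MvPolynomial.eval_eq, Finset.mul_sum]
  refine Finset.sum_congr rfl fun d hd => ?_
  have hdeg : n = ∑ i ∈ d.support, d i := hF.degree_eq_sum_deg_support hd
  rw [hdeg]
  simp only [Pi.smul_apply, smul_eq_mul, mul_pow, Finset.prod_mul_distrib, Finset.prod_pow_eq_pow_sum]
  ring

/-- For a form, membership in the critical locus can be tested on any homogeneous coordinates. -/
theorem mk_mem_criticalLocus_iff {B : MvPolynomial (Fin 3) K} {n : ℕ}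
    (hB : B.IsHomogeneous n) (v : Fin 3 → K) (hv : v ≠ 0) :
    Projectivization.mk K v hv ∈ criticalLocus B ↔
      ∀ k : Fin 3, MvPolynomial.eval v (MvPolynomial.pderiv k B) = 0 := by
  obtain ⟨a, ha⟩ := Projectivization.exists_smul_eq_mk_rep K v hv
  have ha' : (Projectivization.mk K v hv).rep = (a : K) • v := ha.symm
  have h0 : (a : K) ≠ 0 := a.ne_zero
  simp only [criticalLocus, Set.mem_ofPred_eq, ha']
  refine forall_congr' fun k => ?_
  rw [eval_smul_of_isHomogeneous (MvPolynomial.IsHomogeneous.pderiv hB)]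
  simp [h0]

/-- Restriction to the standard affine chart `x_i ≠ 0` of the plane: put `x_i = 1`. The remaining
variables are the affine coordinates `x_j / x_i`, `j ≠ i`. -/
noncomputable def dehomogenize (i : Fin 3) :
    MvPolynomial (Fin 3) K →ₐ[K] MvPolynomial {j : Fin 3 // j ≠ i} K :=
  MvPolynomial.aeval fun j => if h : j = i then 1 else MvPolynomial.X ⟨j, h⟩

/-- The coordinate ring of the critical scheme `B_1 = B_2 = B_3 = 0` (the closed subscheme of the
plane cut out by the partial derivatives of the form `B`) in the affine chart `x_i ≠ 0`. -/
abbrev CriticalChart (B : MvPolynomial (Fin 3) K) (i : Fin 3) : Type _ :=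
  MvPolynomial {j : Fin 3 // j ≠ i} K ⧸
    Ideal.span (Set.range fun k : Fin 3 => dehomogenize i (MvPolynomial.pderiv k B))

/-- The critical scheme of `B` is reduced: it is covered by the spectra of the three chart rings,
so this says that each of them is reduced. -/
def CriticalSchemeIsReduced (B : MvPolynomial (Fin 3) K) : Prop :=
  ∀ i : Fin 3, IsReduced (CriticalChart B i)

/-- The critical scheme of `B` consists of exactly `n` reduced points. -/
def HasExactlyReducedCriticalPoints (B : MvPolynomial (Fin 3) K) (n : ℕ) : Prop :=
  (criticalLocus B).Finite ∧ (criticalLocus B).ncard = n ∧ CriticalSchemeIsReduced B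

/-- The exponents of the 15 ternary quartic monomials. -/
abbrev QuarticExponent : Type := {m : Fin 3 →₀ ℕ // m.degree = 4}

/-- The coefficient vector of a ternary quartic form. It identifies the quartic forms with the
affine space of all functions `QuarticExponent → K`. -/
def quarticCoeffs (B : MvPolynomial (Fin 3) K) : QuarticExponent → K :=
  fun m => B.coeff m.1

/-- Zariski-open subsets of an affine space: complements of zero loci of ideals of polynomials. -/
def IsZariskiOpen {ι : Type*} (U : Set (ι → K)) : Prop :=
  ∃ I : Ideal (MvPolynomial ι K), U = (MvPolynomial.zeroLocus K I)ᶜ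

/-- A property holds for the general quartic form if it holds for all forms in some nonempty
Zariski-open subset of the affine space of quartic forms. -/
def HoldsForGeneralQuartic (P : MvPolynomial (Fin 3) K → Prop) : Prop :=
  ∃ U : Set (QuarticExponent → K), IsZariskiOpen U ∧ U.Nonempty ∧
    ∀ B : MvPolynomial (Fin 3) K, B.IsHomogeneous 4 → quarticCoeffs B ∈ U → P B

/-- The Klein quartic `x_1^3 x_2 + x_2^3 x_3 + x_3^3 x_1`. -/
noncomputable def kleinQuartic (K : Type*) [Field K] : MvPolynomial (Fin 3) K :=
  MvPolynomial.X 0 ^ 3 * MvPolynomial.X 1 + MvPolynomial.X 1 ^ 3 * MvPolynomial.X 2 +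
    MvPolynomial.X 2 ^ 3 * MvPolynomial.X 0

theorem kleinVector_ne_zero (ε : K) : (![1, ε, ε ^ 5] : Fin 3 → K) ≠ 0 := by
  intro h
  simpa using congrFun h 0

/-- The point `(1 : ε : ε^5)` of the projective plane. -/
def kleinPoint (ε : K) : ℙ K (Fin 3 → K) :=
  Projectivization.mk K ![1, ε, ε ^ 5] (kleinVector_ne_zero ε)

end CharTwoQuartic

namespace CharTwoQuartic

/-! In characteristic two only nine coefficients of a quartic survive in its gradient. In a chart
`x_i = 1` with coordinates `x`, `y`, Euler's relation `∑ x_k B_k = 4B = 0` makes `B_i` redundant.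
The derivative along `y` has only even powers of `y`, so it reads `L(x) y² = G(x)` with `deg L ≤ 1`,
`deg G ≤ 3`. Multiplying the other derivative by `L` and substituting makes it linear, `P(x) y =
N(x)`, with `deg P ≤ 2`, `deg N ≤ 3`. Hence `x` is a root of `E = N² L + P² G`, of degree at most
`7`. Conversely, every root of `E` with `L ≠ 0` comes from a critical point, `K` being algebraically
closed (`exists_mem_criticalLocus`).

Upper bound: a linear change of coordinates puts a finite critical locus into one chart with
distinct `x`-coordinates (`exists_separating`). Finiteness then forces `E ≠ 0`, so there are at most
seven points.

General quartic: if `E` has degree `7` and is coprime to `E' P L`, then its seven simple roots all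
lift, and `y` is a polynomial in `x` on the chart, whose ring is thus a quotient of `K[x]/(E)` and
reduced. This condition is the nonvanishing of a leading coefficient times a resultant, so it is
open. The Klein quartic satisfies it, with `E = x⁷ + 1`. -/

/-! ### The gradient of a quartic in characteristic two -/

/-- The coefficients of a ternary quartic that survive in its gradient in characteristic two: those
of `x_i^3 x_{i+1}`, `x_i^3 x_{i+2}` and `x_i^2 x_{i+1} x_{i+2}`. -/
structure GradCoeffs (R : Type*) where
  u : Fin 3 → R
  v : Fin 3 → R
  w : Fin 3 → R

/-- The exponent `a e_i + b e_{i+1} + c e_{i+2}`. -/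
noncomputable def exponent (i : Fin 3) (a b c : ℕ) : Fin 3 →₀ ℕ :=
  Finsupp.equivFunOnFinite.symm fun j => if j = i then a else if j = i + 1 then b else c

theorem degree_exponent (i : Fin 3) (a b c : ℕ) : (exponent i a b c).degree = a + b + c := by
  fin_cases i <;> simp [exponent, Finsupp.degree_eq_sum, Fin.sum_univ_three] <;> omega

namespace GradCoeffs

/-- The gradient coefficients read off from a coefficient vector. -/
noncomputable def ofVector {R : Type*} (c : QuarticExponent → R) : GradCoeffs R where
  u i := c ⟨exponent i 3 1 0, by simp [degree_exponent]⟩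
  v i := c ⟨exponent i 3 0 1, by simp [degree_exponent]⟩
  w i := c ⟨exponent i 2 1 1, by simp [degree_exponent]⟩

/-- Transport along a map of coefficients. -/
def map {R S : Type*} (f : R → S) (c : GradCoeffs R) : GradCoeffs S where
  u i := f (c.u i)
  v i := f (c.v i)
  w i := f (c.w i)

/-- The `k`-th component of the gradient of a quartic in characteristic two. -/
def grad {R : Type*} [CommRing R] (c : GradCoeffs R) (t : Fin 3 → R) (k : Fin 3) : R :=
  t k ^ 2 * (c.u k * t (k + 1) + c.v k * t (k + 2)) +
    c.v (k + 1) * t (k + 1) ^ 3 + c.u (k + 2) * t (k + 2) ^ 3 +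
    c.w (k + 1) * t (k + 1) ^ 2 * t (k + 2) + c.w (k + 2) * t (k + 1) * t (k + 2) ^ 2

end GradCoeffs

variable {K : Type*} [Field K]

theorem eq_sum_monomials {B : MvPolynomial (Fin 3) K} (hB : B.IsHomogeneous 4) :
    B = ∑ m ∈ Finset.Nat.antidiagonalTuple 3 4,
      MvPolynomial.monomial (Finsupp.equivFunOnFinite.symm m)
        (B.coeff (Finsupp.equivFunOnFinite.symm m)) := by
  classical
  ext d
  rw [MvPolynomial.coeff_sum]
  simp only [MvPolynomial.coeff_monomial]
  by_cases hd : d.degree = 4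
  · rw [Finset.sum_eq_single (Finsupp.equivFunOnFinite d)]
    · simp
    · intro m _ hm
      rw [if_neg]
      rintro rfl
      simp at hm
    · intro h
      exact absurd (by simpa [Finset.Nat.mem_antidiagonalTuple, Finsupp.degree_eq_sum] using hd) h
  · rw [hB.coeff_eq_zero hd, Finset.sum_eq_zero]
    intro m hm
    rw [if_neg]
    rintro rfl
    apply hd
    simpa [Finset.Nat.mem_antidiagonalTuple, Finsupp.degree_eq_sum] using hm

theorem aeval_pderiv_monomial {A : Type*} [CommRing A] [Algebra K A] (t : Fin 3 → A) (k : Fin 3)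
    (m : Fin 3 → ℕ) (a : K) :
    MvPolynomial.aeval t (MvPolynomial.pderiv k
      (MvPolynomial.monomial (Finsupp.equivFunOnFinite.symm m) a)) =
      algebraMap K A a * m k * ∏ j, t j ^ (m j - if j = k then 1 else 0) := by
  rw [MvPolynomial.pderiv_monomial, MvPolynomial.aeval_monomial, Finsupp.prod_fintype _ _ (by simp)]
  simp [Finsupp.single_apply, eq_comm]

theorem exponent_zero (a b c : ℕ) :
    exponent 0 a b c = Finsupp.equivFunOnFinite.symm ![a, b, c] := by
  ext j; fin_cases j <;> rfl

theorem exponent_one (a b c : ℕ) :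
    exponent 1 a b c = Finsupp.equivFunOnFinite.symm ![c, a, b] := by
  ext j; fin_cases j <;> rfl

theorem exponent_two (a b c : ℕ) :
    exponent 2 a b c = Finsupp.equivFunOnFinite.symm ![b, c, a] := by
  ext j; fin_cases j <;> rfl

/-- Differentiation kills every monomial with only even exponents. The values lie in an arbitrary
`K`-algebra so that the formula serves both for points (`A = K`) and for the chart rings. -/
theorem aeval_pderiv [CharP K 2] {B : MvPolynomial (Fin 3) K} (hB : B.IsHomogeneous 4)
    {A : Type*} [CommRing A] [Algebra K A] (t : Fin 3 → A) (k : Fin 3) :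
    MvPolynomial.aeval t (MvPolynomial.pderiv k B) =
      ((GradCoeffs.ofVector (quarticCoeffs B)).map (algebraMap K A)).grad t k := by
  have h2 : (2 : A) = 0 := by
    have := congrArg (algebraMap K A) (CharTwo.two_eq_zero (R := K))
    rwa [map_ofNat, map_zero] at this
  have key : Finset.Nat.antidiagonalTuple 3 4 =
    {![4,0,0], ![0,4,0], ![0,0,4], ![3,1,0], ![3,0,1], ![1,3,0], ![0,3,1], ![1,0,3], ![0,1,3],
      ![2,2,0], ![2,0,2], ![0,2,2], ![2,1,1], ![1,2,1], ![1,1,2]} := by decide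
  have h3 : (3 : A) = 1 := by linear_combination h2
  have h4 : (4 : A) = 0 := by linear_combination 2 * h2
  have i1 : (1 : Fin 3) + 1 = 2 := rfl
  have i2 : (1 : Fin 3) + 2 = 0 := rfl
  have i3 : (2 : Fin 3) + 1 = 0 := rfl
  have i4 : (2 : Fin 3) + 2 = 1 := rfl
  have hs := eq_sum_monomials hB
  rw [key] at hs
  repeat rw [Finset.sum_insert (by decide)] at hs
  rw [Finset.sum_singleton] at hs
  have hs' := congrArg (fun F => MvPolynomial.aeval t (MvPolynomial.pderiv k F)) hs
  simp only [map_add, aeval_pderiv_monomial] at hs'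
  rw [hs']
  clear hs hs'
  fin_cases k <;>
    simp [GradCoeffs.grad, GradCoeffs.map, GradCoeffs.ofVector, quarticCoeffs, exponent_zero,
      exponent_one, exponent_two, Fin.prod_univ_three, h2, h3, h4, i1, i2, i3, i4] <;>
    ring

/-! ### Elimination of one affine coordinate -/

namespace GradCoeffs

open Polynomial

section Elimination

variable {R : Type*} [CommRing R] (c : GradCoeffs R) (i : Fin 3)

/-- In the chart `x_i = 1` with coordinates `x = x_{i+1}`, `y = x_{i+2}`, the coefficient of `y ^ 2`
in the partial derivative along `y`. -/
noncomputable def quadCoeff : R[X] := C (c.v (i + 2)) * X + C (c.u (i + 2))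

/-- The part free of `y` of the partial derivative along `y`. -/
noncomputable def quadConst : R[X] :=
  C (c.u (i + 1)) * X ^ 3 + C (c.w (i + 1)) * X ^ 2 + C (c.w i) * X + C (c.v i)

/-- The denominator of `y` as a rational function of `x` on the critical locus. -/
noncomputable def denom : R[X] :=
  C (c.v (i + 2) * c.w (i + 1) + c.u (i + 1) * c.u (i + 2)) * X ^ 2 +
    C (c.v (i + 2) * c.v i + c.w i * c.u (i + 2))

/-- The numerator of `y` as a rational function of `x` on the critical locus. -/
noncomputable def numer : R[X] :=
  C (c.w (i + 2)) * c.quadConst i + (C (c.v (i + 1)) * X ^ 2 + C (c.u i)) * c.quadCoeff i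

/-- The polynomial of degree at most seven satisfied by `x` on the critical locus. -/
noncomputable def eliminant : R[X] :=
  c.numer i ^ 2 * c.quadCoeff i + c.denom i ^ 2 * c.quadConst i

/-- The product of the polynomials that must not vanish at a root of the eliminant for this root to
be simple and to come from a critical point. -/
noncomputable def discriminating : R[X] :=
  derivative (c.eliminant i) * c.denom i * c.quadCoeff i

/-- The source of the number seven: the two summands have degrees at most `2 * 3 + 1` and `2 * 2 +
3`. -/
theorem natDegree_eliminant_le : (c.eliminant i).natDegree ≤ 7 := by
  unfold eliminant numer denom quadConst quadCoeff
  compute_degree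

theorem natDegree_discriminating_le : (c.discriminating i).natDegree ≤ 9 := by
  have h1 : (derivative (c.eliminant i)).natDegree ≤ 6 :=
    (natDegree_derivative_le _).trans (by have := c.natDegree_eliminant_le i; omega)
  have h2 : (c.denom i).natDegree ≤ 2 := by
    unfold denom; compute_degree
  have h3 : (c.quadCoeff i).natDegree ≤ 1 := by
    unfold quadCoeff; compute_degree
  exact natDegree_mul_le_of_le (natDegree_mul_le_of_le h1 h2) h3

section Map

variable {S : Type*} [CommRing S] (f : R →+* S)

theorem map_quadCoeff : (c.map f).quadCoeff i = (c.quadCoeff i).map f := by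
  simp [quadCoeff, map]

theorem map_quadConst : (c.map f).quadConst i = (c.quadConst i).map f := by
  simp [quadConst, map]

theorem map_denom : (c.map f).denom i = (c.denom i).map f := by
  simp [denom, map]

theorem map_numer : (c.map f).numer i = (c.numer i).map f := by
  simp only [numer, map_quadConst, map_quadCoeff]
  simp [map]

theorem map_eliminant : (c.map f).eliminant i = (c.eliminant i).map f := by
  simp [eliminant, map_quadConst, map_quadCoeff, map_numer, map_denom]

theorem map_discriminating : (c.map f).discriminating i = (c.discriminating i).map f := by
  simp [discriminating, map_eliminant, map_quadCoeff, map_denom, derivative_map]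

end Map

theorem forall_fin_three_iff {p : Fin 3 → Prop} (i : Fin 3) :
    (∀ k, p k) ↔ p i ∧ p (i + 1) ∧ p (i + 2) := by
  fin_cases i <;> simp [Fin.forall_fin_succ] <;> tauto

theorem grad_chart {t : Fin 3 → R} (ht : t i = 1) :
    c.grad t i = c.u i * t (i + 1) + c.v i * t (i + 2) + c.v (i + 1) * t (i + 1) ^ 3 +
        c.u (i + 2) * t (i + 2) ^ 3 + c.w (i + 1) * t (i + 1) ^ 2 * t (i + 2) +
        c.w (i + 2) * t (i + 1) * t (i + 2) ^ 2 ∧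
      c.grad t (i + 1) = t (i + 1) ^ 2 * (c.u (i + 1) * t (i + 2) + c.v (i + 1)) +
        c.v (i + 2) * t (i + 2) ^ 3 + c.u i + c.w (i + 2) * t (i + 2) ^ 2 + c.w i * t (i + 2) ∧
      c.grad t (i + 2) = t (i + 2) ^ 2 * (c.u (i + 2) + c.v (i + 2) * t (i + 1)) +
        c.v i + c.u (i + 1) * t (i + 1) ^ 3 + c.w i * t (i + 1) + c.w (i + 1) * t (i + 1) ^ 2 := by
  have h := (by decide : ∀ j : Fin 3,
    j + 1 + 1 = j + 2 ∧ j + 1 + 2 = j ∧ j + 2 + 1 = j ∧ j + 2 + 2 = j + 1) i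
  simp only [grad, h, ht]
  refine ⟨?_, ?_, ?_⟩ <;> ring

/-- The equations satisfied by the affine coordinates of a critical point. -/
theorem relations_of_grad_eq_zero (h2 : (2 : R) = 0) {t : Fin 3 → R} (ht : t i = 1)
    (h : ∀ k, c.grad t k = 0) :
    (c.quadCoeff i).eval (t (i + 1)) * t (i + 2) ^ 2 = (c.quadConst i).eval (t (i + 1)) ∧
      (c.denom i).eval (t (i + 1)) * t (i + 2) = (c.numer i).eval (t (i + 1)) ∧
      (c.eliminant i).eval (t (i + 1)) = 0 := by
  obtain ⟨-, hf, hg⟩ := c.grad_chart i ht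
  rw [h] at hf hg
  generalize t (i + 1) = x at *
  generalize t (i + 2) = y at *
  have key1 : (c.quadCoeff i).eval x * y ^ 2 = (c.quadConst i).eval x := by
    simp [quadCoeff, quadConst]
    linear_combination -hg - h2 * (c.v i + c.u (i + 1) * x ^ 3 + c.w i * x + c.w (i + 1) * x ^ 2)
  -- The derivative along `x` is cubic in `y`. After multiplication by `L`, both `L y³` and `L y²`
  -- are reduced by `L y² = G`; the odd powers of `x` in the coefficient of `y` cancel in pairs
  -- because `2 = 0`.
  have key2 : (c.denom i).eval x * y = (c.numer i).eval x := by
    simp only [quadCoeff, quadConst, denom, numer, eval_add, eval_mul, eval_C, eval_X,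
      eval_pow] at key1 ⊢
    linear_combination -(c.v (i + 2) * x + c.u (i + 2)) * hf -
      (c.v (i + 2) * y + c.w (i + 2)) * key1 -
      h2 * (c.v (i + 2) * c.u (i + 1) * x ^ 3 * y + c.v (i + 2) * x * c.w i * y +
        (c.v (i + 2) * x + c.u (i + 2)) * (c.u i + x ^ 2 * c.v (i + 1)) +
        c.w (i + 2) * (c.w (i + 1) * x ^ 2 + c.u (i + 1) * x ^ 3 + x * c.w i + c.v i))
  refine ⟨key1, key2, ?_⟩
  simp only [eliminant, eval_add, eval_mul, eval_pow]
  rw [← key1, ← key2]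
  -- Both summands of the eliminant equal `P² y² L`, so their sum is twice this term.
  linear_combination ((c.denom i).eval x) ^ 2 * y ^ 2 * (c.quadCoeff i).eval x * h2

/-- Conversely, these equations give a critical point as long as the quadratic coefficient does not
vanish. -/
theorem grad_eq_zero_of_relations [IsDomain R] (h2 : (2 : R) = 0) {t : Fin 3 → R} (ht : t i = 1)
    (hL : (c.quadCoeff i).eval (t (i + 1)) ≠ 0)
    (hG : (c.quadCoeff i).eval (t (i + 1)) * t (i + 2) ^ 2 = (c.quadConst i).eval (t (i + 1)))
    (hN : (c.denom i).eval (t (i + 1)) * t (i + 2) = (c.numer i).eval (t (i + 1))) :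
    ∀ k, c.grad t k = 0 := by
  obtain ⟨he, hf, hg⟩ := c.grad_chart i ht
  rw [forall_fin_three_iff i]
  generalize t (i + 1) = x at *
  generalize t (i + 2) = y at *
  have hg0 : c.grad t (i + 2) = 0 := by
    rw [hg]
    simp only [quadCoeff, quadConst, eval_add, eval_mul, eval_C, eval_X, eval_pow] at hG
    linear_combination hG + h2 * (c.v i + c.u (i + 1) * x ^ 3 + c.w i * x + c.w (i + 1) * x ^ 2)
  have hf0 : c.grad t (i + 1) = 0 := by
    refine (mul_eq_zero.mp (?_ : (c.quadCoeff i).eval x * c.grad t (i + 1) = 0)).resolve_left hL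
    rw [hf]
    simp only [quadCoeff, quadConst, denom, numer, eval_add, eval_mul, eval_C, eval_X,
      eval_pow] at hG hN ⊢
    linear_combination hN + (c.v (i + 2) * y + c.w (i + 2)) * hG +
      h2 * (c.v (i + 2) * c.u (i + 1) * x ^ 3 * y + c.v (i + 2) * x * c.w i * y +
        (c.v (i + 2) * x + c.u (i + 2)) * (c.u i + x ^ 2 * c.v (i + 1)) +
        c.w (i + 2) * (c.w (i + 1) * x ^ 2 + c.u (i + 1) * x ^ 3 + x * c.w i + c.v i))
  refine ⟨?_, hf0, hg0⟩
  rw [hf] at hf0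
  rw [hg] at hg0
  rw [he]
  -- Euler's relation in the chart: `B_i + x B_{i+1} + y B_{i+2}` is a multiple of `2`.
  linear_combination -x * hf0 - y * hg0 + h2 * (c.u i * x + c.v i * y + c.v (i + 1) * x ^ 3 +
    c.u (i + 2) * y ^ 3 + c.w (i + 1) * x ^ 2 * y + c.w (i + 2) * x * y ^ 2 +
    c.u (i + 1) * x ^ 3 * y + c.v (i + 2) * x * y ^ 3 + c.w i * x * y)

end Elimination

/-! ### Genericity and reducedness -/

/-- The open condition on a quartic under which its critical points in the chart `x_i = 1` are given
by the seven simple roots of the eliminant. -/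
def IsGeneric (c : GradCoeffs K) (i : Fin 3) : Prop :=
  (c.eliminant i).coeff 7 ≠ 0 ∧ IsCoprime (c.eliminant i) (c.discriminating i)

/-- The polynomial in the coefficients whose nonvanishing expresses genericity. -/
noncomputable def genericity {R : Type*} [CommRing R] (c : GradCoeffs R) (i : Fin 3) : R :=
  (c.eliminant i).coeff 7 * resultant (c.eliminant i) (c.discriminating i) 7 9

/-- The resultant is taken with the fixed degrees `7` and `9`, so it commutes with ring maps under
which the actual degrees drop. -/
theorem genericity_map {R S : Type*} [CommRing R] [CommRing S] (f : R →+* S) (c : GradCoeffs R)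
    (i : Fin 3) : (c.map f).genericity i = f (c.genericity i) := by
  rw [genericity, map_eliminant, map_discriminating, coeff_map, resultant_map_map, ← map_mul,
    genericity]

theorem genericity_ne_zero_iff (c : GradCoeffs K) (i : Fin 3) :
    c.genericity i ≠ 0 ↔ c.IsGeneric i := by
  rw [genericity, mul_ne_zero_iff, IsGeneric]
  refine and_congr_right fun h7 => ?_
  have hdeg : (c.eliminant i).natDegree = 7 :=
    natDegree_eq_of_le_of_coeff_ne_zero (c.natDegree_eliminant_le i) h7
  obtain ⟨k, hk⟩ := Nat.exists_eq_add_of_le (c.natDegree_discriminating_le i)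
  have h0 : c.eliminant i ≠ 0 := by
    intro h
    simp [h] at h7
  -- The excess of `9` over the true degree contributes only a power of the leading coefficient of
  -- the eliminant, which is nonzero.
  rw [hk, resultant_add_right_deg _ _ _ _ _ le_rfl, mul_ne_zero_iff]
  have hres : resultant (c.eliminant i) (c.discriminating i) 7 =
      resultant (c.eliminant i) (c.discriminating i) := by rw [hdeg]
  rw [hres, ne_eq, ne_eq, resultant_eq_zero_iff]
  simp [h0, h7]

variable {c : GradCoeffs K} {i : Fin 3}

namespace IsGeneric

theorem natDegree_eliminant (h : c.IsGeneric i) : (c.eliminant i).natDegree = 7 :=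
  natDegree_eq_of_le_of_coeff_ne_zero (c.natDegree_eliminant_le i) h.1

theorem separable (h : c.IsGeneric i) : (c.eliminant i).Separable :=
  h.2.of_mul_right_left.of_mul_right_left

theorem isCoprime_denom (h : c.IsGeneric i) : IsCoprime (c.eliminant i) (c.denom i) :=
  h.2.of_mul_right_left.of_mul_right_right

theorem isCoprime_quadCoeff (h : c.IsGeneric i) : IsCoprime (c.eliminant i) (c.quadCoeff i) :=
  h.2.of_mul_right_right

end IsGeneric

theorem eval_ne_zero_of_isCoprime {p q : K[X]} (h : IsCoprime p q) {x : K} (hx : p.eval x = 0) :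
    q.eval x ≠ 0 := by
  obtain ⟨a, b, hab⟩ := h
  intro hq
  have := congrArg (Polynomial.eval x) hab
  simp [hx, hq] at this

/-- A quotient of the polynomial ring in one variable in which a squarefree polynomial vanishes is
reduced. -/
theorem isReduced_of_aeval_surjective {A : Type*} [CommRing A] [Algebra K A] {x : A}
    (hx : Function.Surjective (aeval (R := K) x)) {p : K[X]} (hp : Squarefree p)
    (h0 : aeval x p = 0) : IsReduced A := by
  obtain ⟨q, hq⟩ := (IsPrincipalIdealRing.principal (RingHom.ker (aeval (R := K) x))).principal
  have hker : ∀ r : K[X], aeval x r = 0 ↔ q ∣ r := fun r => by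
    rw [← Ideal.mem_span_singleton, ← Ideal.submodule_span_eq, ← hq, RingHom.mem_ker]
  have hrad : IsRadical q := (hp.squarefree_of_dvd ((hker p).mp h0)).isRadical
  refine ⟨fun a ⟨n, hn⟩ => ?_⟩
  obtain ⟨r, rfl⟩ := hx a
  rw [← map_pow, hker] at hn
  exact (hker r).mpr (hrad n r hn)

/-- Since `E(x) = 0` in `A`, a Bézout relation `a E + b P = 1` makes `P(x)` invertible, whence `y =
b(x) N(x)`. So `x` alone generates `A`, and it is killed by the squarefree `E`. -/
theorem isReduced_of_isGeneric {A : Type*} [CommRing A] [Algebra K A] (h2 : (2 : A) = 0)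
    (hc : c.IsGeneric i) {t : Fin 3 → A} (ht : t i = 1)
    (hgen : Algebra.adjoin K (Set.range t) = ⊤)
    (h : ∀ k, (c.map (algebraMap K A)).grad t k = 0) : IsReduced A := by
  obtain ⟨-, hN, hp⟩ := (c.map (algebraMap K A)).relations_of_grad_eq_zero i h2 ht h
  rw [map_denom, map_numer, eval_map_algebraMap, eval_map_algebraMap] at hN
  rw [map_eliminant, eval_map_algebraMap] at hp
  refine isReduced_of_aeval_surjective (x := t (i + 1)) ?_ hc.separable.squarefree hp
  obtain ⟨a, b, hab⟩ := hc.isCoprime_denom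
  have hy : t (i + 2) = aeval (t (i + 1)) (b * c.numer i) := by
    have := congrArg (aeval (t (i + 1))) hab
    simp only [map_add, map_mul, hp, map_one] at this ⊢
    rw [← hN]
    linear_combination -t (i + 2) * this
  rw [← AlgHom.range_eq_top, eq_top_iff, ← hgen, Algebra.adjoin_le_iff]
  rintro _ ⟨k, rfl⟩
  revert k
  rw [forall_fin_three_iff i]
  refine ⟨?_, ⟨X, by simp⟩, ⟨_, hy.symm⟩⟩
  rw [ht]
  exact one_mem _

end GradCoeffs
/-- The gradient coefficients of a quartic form. -/
noncomputable abbrev gradCoeffs (B : MvPolynomial (Fin 3) K) : GradCoeffs K :=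
  GradCoeffs.ofVector (quarticCoeffs B)

/-! ### Affine charts of the projective plane -/

section Chart

theorem rep_mk_div_rep_mk {v : Fin 3 → K} (hv : v ≠ 0) (i j : Fin 3) :
    (Projectivization.mk K v hv).rep j / (Projectivization.mk K v hv).rep i = v j / v i := by
  obtain ⟨a, ha⟩ := Projectivization.exists_smul_eq_mk_rep K v hv
  rw [← ha]
  simp [Units.smul_def, mul_div_mul_left]

/-- The affine coordinates of a point in the chart `x_i = 1`. -/
noncomputable def chartVector (i : Fin 3) (p : ℙ K (Fin 3 → K)) : Fin 3 → K :=
  fun j => p.rep j / p.rep i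

theorem chartVector_ne_zero {i : Fin 3} {p : ℙ K (Fin 3 → K)} (h : p.rep i ≠ 0) :
    chartVector i p ≠ 0 :=
  fun h0 => one_ne_zero (α := K) (by simpa [chartVector, h] using congrFun h0 i)

theorem mk_chartVector {i : Fin 3} {p : ℙ K (Fin 3 → K)} (h : p.rep i ≠ 0) :
    Projectivization.mk K (chartVector i p) (chartVector_ne_zero h) = p := by
  conv_rhs => rw [← p.mk_rep]
  rw [Projectivization.mk_eq_mk_iff']
  exact ⟨(p.rep i)⁻¹, by ext j; simp [chartVector, div_eq_inv_mul]⟩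

theorem dehomogenize_X_self (i : Fin 3) :
    dehomogenize (K := K) i (MvPolynomial.X i) = 1 := by
  simp [dehomogenize]

theorem dehomogenize_surjective (i : Fin 3) : Function.Surjective (dehomogenize (K := K) i) := by
  rw [← AlgHom.range_eq_top, eq_top_iff, ← MvPolynomial.adjoin_range_X, Algebra.adjoin_le_iff]
  rintro _ ⟨⟨j, hj⟩, rfl⟩
  exact ⟨MvPolynomial.X j, by simp [dehomogenize, hj]⟩

end Chart

/-! ### Critical points and roots of the eliminant -/

section Projective

variable [CharP K 2] {B : MvPolynomial (Fin 3) K}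

theorem mk_mem_criticalLocus_iff_grad (hB : B.IsHomogeneous 4) {v : Fin 3 → K} (hv : v ≠ 0) :
    Projectivization.mk K v hv ∈ criticalLocus B ↔ ∀ k, (gradCoeffs B).grad v k = 0 := by
  rw [mk_mem_criticalLocus_iff hB]
  refine forall_congr' fun k => ?_
  rw [← MvPolynomial.coe_aeval_eq_eval, RingHom.coe_coe, aeval_pderiv hB v k]
  rfl

theorem chartVector_relations (hB : B.IsHomogeneous 4) {i : Fin 3} {p : ℙ K (Fin 3 → K)}
    (hp : p ∈ criticalLocus B) (h : p.rep i ≠ 0) :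
    ((gradCoeffs B).denom i).eval (chartVector i p (i + 1)) * chartVector i p (i + 2) =
        ((gradCoeffs B).numer i).eval (chartVector i p (i + 1)) ∧
      ((gradCoeffs B).eliminant i).eval (chartVector i p (i + 1)) = 0 := by
  rw [← mk_chartVector h, mk_mem_criticalLocus_iff_grad hB] at hp
  exact ((gradCoeffs B).relations_of_grad_eq_zero i CharTwo.two_eq_zero
    (by simp [chartVector, h]) hp).2

/-- A root of the eliminant at which the quadratic coefficient does not vanish is the coordinate of
a critical point. -/
theorem exists_mem_criticalLocus [IsAlgClosed K] (hB : B.IsHomogeneous 4) {i : Fin 3} {x : K}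
    (hx : ((gradCoeffs B).eliminant i).eval x = 0)
    (hL : ((gradCoeffs B).quadCoeff i).eval x ≠ 0) :
    ∃ p ∈ criticalLocus B, chartVector i p (i + 1) = x := by
  set c := gradCoeffs B with hc
  have h2 : (2 : K) = 0 := CharTwo.two_eq_zero
  rw [GradCoeffs.eliminant] at hx
  simp only [Polynomial.eval_add, Polynomial.eval_mul, Polynomial.eval_pow] at hx
  obtain ⟨y, hG, hN⟩ : ∃ y, (c.quadCoeff i).eval x * y ^ 2 = (c.quadConst i).eval x ∧
      (c.denom i).eval x * y = (c.numer i).eval x := by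
    by_cases hP : (c.denom i).eval x = 0
    -- If `P(x) = 0`, then `E(x) = 0` and `L(x) ≠ 0` give `N(x) = 0`. The linear relation is then
    -- void and any square root of `G / L` serves as `y`.
    · obtain ⟨y, hy⟩ := IsAlgClosed.exists_pow_nat_eq
        ((c.quadConst i).eval x / (c.quadCoeff i).eval x) two_pos
      refine ⟨y, by rw [hy]; field_simp, ?_⟩
      have hN : (c.numer i).eval x = 0 := by simpa [hP, hL] using hx
      rw [hP, hN, zero_mul]
    · refine ⟨(c.numer i).eval x / (c.denom i).eval x, ?_, by field_simp⟩
      field_simp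
      linear_combination hx - h2 * (c.denom i).eval x ^ 2 * (c.quadConst i).eval x
  have hi : i + 1 ≠ i ∧ i + 2 ≠ i ∧ i + 2 ≠ i + 1 :=
    (by decide : ∀ j : Fin 3, j + 1 ≠ j ∧ j + 2 ≠ j ∧ j + 2 ≠ j + 1) i
  let t : Fin 3 → K := fun j => if j = i then 1 else if j = i + 1 then x else y
  have t0 : t i = 1 := by simp [t]
  have t1 : t (i + 1) = x := by simp [t, hi]
  have t2 : t (i + 2) = y := by simp [t, hi]
  have ht : t ≠ 0 := fun h => by simp [h] at t0
  refine ⟨Projectivization.mk K t ht, ?_, ?_⟩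
  · rw [mk_mem_criticalLocus_iff_grad hB]
    apply c.grad_eq_zero_of_relations i h2 t0 <;> rw [t1] <;> first | assumption | rwa [t2]
  · rw [chartVector, rep_mk_div_rep_mk, t0, t1, div_one]

/-- In each chart `x` is one of finitely many roots of `E`, and it determines `y = N / P` since `P`
does not vanish there. -/
theorem finite_of_isGeneric (hB : B.IsHomogeneous 4) (h : ∀ i, (gradCoeffs B).IsGeneric i) :
    (criticalLocus B).Finite := by
  have hcover : criticalLocus B ⊆ ⋃ i : Fin 3, {p ∈ criticalLocus B | p.rep i ≠ 0} := by
    intro p hp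
    obtain ⟨i, hi⟩ := Function.ne_iff.mp p.rep_nonzero
    exact Set.mem_iUnion.mpr ⟨i, hp, hi⟩
  refine (Set.finite_iUnion fun i => ?_).subset hcover
  have h0 : (gradCoeffs B).eliminant i ≠ 0 := (h i).separable.ne_zero
  refine Set.Finite.of_injOn (f := fun p => chartVector i p (i + 1))
    (t := {x | ((gradCoeffs B).eliminant i).IsRoot x}) ?_ ?_
    (Polynomial.finite_setOfPred_isRoot h0)
  · rintro p ⟨hp, hpi⟩
    exact (chartVector_relations hB hp hpi).2
  · rintro p ⟨hp, hpi⟩ q ⟨hq, hqi⟩ hpq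
    obtain ⟨hp1, hp2⟩ := chartVector_relations hB hp hpi
    obtain ⟨hq1, -⟩ := chartVector_relations hB hq hqi
    have hP := GradCoeffs.eval_ne_zero_of_isCoprime (h i).isCoprime_denom hp2
    dsimp only at hpq
    rw [← hpq, ← hp1] at hq1
    have hy := mul_left_cancel₀ hP hq1
    have : chartVector i p = chartVector i q := by
      funext k
      revert k
      rw [GradCoeffs.forall_fin_three_iff i]
      exact ⟨by simp [chartVector, hpi, hqi], hpq, hy.symm⟩
    rw [← mk_chartVector hpi, ← mk_chartVector hqi]
    simp only [this]

theorem seven_le_ncard_of_isGeneric [IsAlgClosed K] (hB : B.IsHomogeneous 4) {i : Fin 3}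
    (h : (gradCoeffs B).IsGeneric i) (hfin : (criticalLocus B).Finite) :
    7 ≤ (criticalLocus B).ncard := by
  classical
  have hcard := Polynomial.card_rootSet_eq_natDegree (K := K) h.separable
    (IsAlgClosed.splits _)
  rw [h.natDegree_eliminant, ← Nat.card_eq_fintype_card, Nat.card_coe_set_eq] at hcard
  rw [← hcard]
  refine (Set.ncard_le_ncard ?_ (hfin.image fun p => chartVector i p (i + 1))).trans
    (Set.ncard_image_le hfin)
  intro x hx
  have hx' : ((gradCoeffs B).eliminant i).eval x = 0 := by
    simpa using (Polynomial.mem_rootSet.mp hx).2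
  obtain ⟨p, hp, hpx⟩ := exists_mem_criticalLocus hB hx'
    (GradCoeffs.eval_ne_zero_of_isCoprime h.isCoprime_quadCoeff hx')
  exact ⟨p, hp, hpx⟩

theorem isReduced_criticalChart (hB : B.IsHomogeneous 4) {i : Fin 3}
    (h : (gradCoeffs B).IsGeneric i) : IsReduced (CriticalChart B i) := by
  let φ : MvPolynomial (Fin 3) K →ₐ[K] CriticalChart B i :=
    (Ideal.Quotient.mkₐ K _).comp (dehomogenize i)
  let t : Fin 3 → CriticalChart B i := fun j => φ (MvPolynomial.X j)
  have hφ : φ = MvPolynomial.aeval t := MvPolynomial.algHom_ext fun j => by simp [t]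
  have h2 : (2 : CriticalChart B i) = 0 := by
    have := congrArg (algebraMap K (CriticalChart B i)) (CharTwo.two_eq_zero (R := K))
    rwa [map_ofNat, map_zero] at this
  refine GradCoeffs.isReduced_of_isGeneric h2 h (t := t) ?_ ?_ fun k => ?_
  · exact (congrArg (Ideal.Quotient.mkₐ K _) (dehomogenize_X_self i)).trans (map_one _)
  · rw [Algebra.adjoin_range_eq_range_aeval, ← hφ, AlgHom.range_eq_top]
    exact (Ideal.Quotient.mkₐ_surjective K _).comp (dehomogenize_surjective i)
  · rw [← aeval_pderiv hB, ← hφ]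
    exact Ideal.Quotient.eq_zero_iff_mem.mpr (Ideal.subset_span ⟨k, rfl⟩)

/-- If the projection from `(0 : 1 : 0)` to the chart `x_2 = 1` separates the critical points, then
there are at most seven of them. -/
theorem ncard_le_seven_of_injOn [IsAlgClosed K] (hB : B.IsHomogeneous 4)
    (hfin : (criticalLocus B).Finite) (h2 : ∀ p ∈ criticalLocus B, p.rep 2 ≠ 0)
    (hinj : Set.InjOn (fun p => chartVector 2 p 0) (criticalLocus B)) :
    (criticalLocus B).ncard ≤ 7 := by
  classical
  set c := gradCoeffs B with hc
  -- The two coefficients of `L` are the values of the gradient at `(0 : 1 : 0)`, up to a zero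
  -- entry; this point lies outside the chart `x_2 = 1` and so is not critical.
  have hL : c.quadCoeff 2 ≠ 0 := by
    intro hL
    have hv : c.v 1 = 0 := by simpa [GradCoeffs.quadCoeff] using congrArg (Polynomial.coeff · 1) hL
    have hu : c.u 1 = 0 := by simpa [GradCoeffs.quadCoeff] using congrArg (Polynomial.coeff · 0) hL
    have ht : (![0, 1, 0] : Fin 3 → K) ≠ 0 := fun h => by simpa using congrFun h 1
    have hmem : Projectivization.mk K _ ht ∈ criticalLocus B := by
      rw [mk_mem_criticalLocus_iff_grad hB]
      intro k
      fin_cases k <;> simp [GradCoeffs.grad, ← hc, hu, hv]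
    apply h2 _ hmem
    obtain ⟨a, ha⟩ := Projectivization.exists_smul_eq_mk_rep K _ ht
    rw [← ha]
    simp
  -- Were `E` zero, every `x` with `L(x) ≠ 0` would lift to a critical point, giving infinitely
  -- many.
  have h0 : c.eliminant 2 ≠ 0 := by
    intro h0
    obtain ⟨x, hx⟩ := ((hfin.image fun p => chartVector 2 p 0).union
      (Polynomial.finite_setOfPred_isRoot hL)).exists_notMem
    rw [Set.mem_union, not_or] at hx
    obtain ⟨p, hp, hpx⟩ := exists_mem_criticalLocus (i := 2) (x := x) hB (by simp [← hc, h0]) hx.2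
    exact hx.1 ⟨p, hp, hpx⟩
  calc (criticalLocus B).ncard
      ≤ ((c.eliminant 2).roots.toFinset : Set K).ncard :=
        Set.ncard_le_ncard_of_injOn _ (fun p hp => by
          have := (chartVector_relations hB hp (h2 p hp)).2
          simpa [h0] using this) hinj (Finset.finite_toSet _)
    _ ≤ 7 := by
        rw [Set.ncard_coe_finset]
        exact (Multiset.toFinset_card_le _).trans
          ((Polynomial.card_roots' _).trans (c.natDegree_eliminant_le 2))

end Projective

/-! ### Linear changes of coordinates -/

section Substitution

variable (M : Matrix (Fin 3) (Fin 3) K) (B : MvPolynomial (Fin 3) K)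

/-- The polynomial `v ↦ B (M v)`. -/
noncomputable def substitute : MvPolynomial (Fin 3) K :=
  MvPolynomial.aeval (fun j => ∑ i, MvPolynomial.C (M j i) * MvPolynomial.X i) B

variable {B} in
theorem isHomogeneous_substitute {n : ℕ} (hB : B.IsHomogeneous n) :
    (substitute M B).IsHomogeneous n := by
  rw [← one_mul n]
  exact hB.aeval _ fun j => MvPolynomial.IsHomogeneous.sum _ _ _ fun i _ =>
    MvPolynomial.isHomogeneous_C_mul_X _ _

theorem eval_substitute (v : Fin 3 → K) :
    MvPolynomial.eval v (substitute M B) = MvPolynomial.eval (M.mulVec v) B := by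
  induction B using MvPolynomial.induction_on with
  | C a => simp [substitute]
  | add p q hp hq => simp_all [substitute]
  | mul_X p j hp => simp_all [substitute, Matrix.mulVec, dotProduct]

theorem pderiv_substitute (k : Fin 3) :
    MvPolynomial.pderiv k (substitute M B) =
      ∑ j, MvPolynomial.C (M j k) * substitute M (MvPolynomial.pderiv j B) := by
  induction B using MvPolynomial.induction_on with
  | C a => simp [substitute]
  | add p q hp hq => simp_all [substitute, mul_add, Finset.sum_add_distrib]
  | mul_X p j hp =>
    have hX : substitute M (MvPolynomial.X j) = ∑ i, MvPolynomial.C (M j i) * MvPolynomial.X i := by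
      simp [substitute]
    have hmul : ∀ p q, substitute M (p * q) = substitute M p * substitute M q := by
      simp [substitute]
    have hadd : ∀ p q, substitute M (p + q) = substitute M p + substitute M q := by
      simp [substitute]
    have hd : MvPolynomial.pderiv k (substitute M (MvPolynomial.X j)) =
        MvPolynomial.C (M j k) := by
      simp [hX, MvPolynomial.pderiv_X, Pi.single_apply]
    have hz : ∀ l, substitute M (MvPolynomial.pderiv l (MvPolynomial.X j)) =
        if l = j then 1 else 0 := fun l => by
      split_ifs with h <;> simp [substitute, MvPolynomial.pderiv_X, h]
    simp only [hmul, hadd, MvPolynomial.pderiv_mul, hp, hd, hz, mul_add, Finset.sum_add_distrib]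
    rw [Finset.sum_mul]
    simp [mul_comm, mul_left_comm]

variable {M B}

/-- By the chain rule the gradient of `B ∘ M` at `v` is `Mᵀ` applied to the gradient of `B` at `M
v`, and `Mᵀ` is injective. -/
theorem mk_mem_criticalLocus_substitute_iff {n : ℕ} (hB : B.IsHomogeneous n) (hM : IsUnit M)
    {v : Fin 3 → K} (hv : v ≠ 0) (hMv : M.mulVec v ≠ 0) :
    Projectivization.mk K v hv ∈ criticalLocus (substitute M B) ↔
      Projectivization.mk K (M.mulVec v) hMv ∈ criticalLocus B := by
  rw [mk_mem_criticalLocus_iff (isHomogeneous_substitute M hB), mk_mem_criticalLocus_iff hB]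
  have hgrad : (fun k => MvPolynomial.eval v (MvPolynomial.pderiv k (substitute M B))) =
      M.transpose.mulVec
        (fun j => MvPolynomial.eval (M.mulVec v) (MvPolynomial.pderiv j B)) := by
    funext k
    simp [pderiv_substitute, eval_substitute, Matrix.mulVec, dotProduct]
  have hinj := Matrix.mulVec_injective_of_isUnit (M.isUnit_transpose.mpr hM)
  constructor
  · intro h k
    have h0 : M.transpose.mulVec
        (fun j => MvPolynomial.eval (M.mulVec v) (MvPolynomial.pderiv j B)) =
        M.transpose.mulVec 0 := by
      rw [← hgrad, Matrix.mulVec_zero]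
      exact funext h
    exact congrFun (hinj h0) k
  · intro h k
    rw [congrFun hgrad k, show (fun j => MvPolynomial.eval (M.mulVec v) _) = (0 : Fin 3 → K) from
      funext h, Matrix.mulVec_zero, Pi.zero_apply]

end Substitution

/-! ### General position and the upper bound -/

theorem exists_forall_eval_ne_zero [Infinite K] {ι : Type*} {S : Set ι} (hS : S.Finite)
    {f : ι → Polynomial K} (hf : ∀ i ∈ S, f i ≠ 0) : ∃ a, ∀ i ∈ S, (f i).eval a ≠ 0 := by
  obtain ⟨a, ha⟩ := (hS.biUnion fun i hi =>
    Polynomial.finite_setOfPred_isRoot (hf i hi)).exists_notMem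
  exact ⟨a, fun i hi h => ha (Set.mem_biUnion hi h)⟩

/-- A coordinate change after which a finite set of points of the plane lies in the chart `x_2 = 1`
and is separated by the coordinate `x_0`. -/
theorem exists_separating [Infinite K] {S : Set (ℙ K (Fin 3 → K))} (hS : S.Finite) :
    ∃ N : Matrix (Fin 3) (Fin 3) K, IsUnit N ∧ (∀ p ∈ S, N.mulVec p.rep 2 ≠ 0) ∧
      ∀ p ∈ S, ∀ q ∈ S, N.mulVec p.rep 0 / N.mulVec p.rep 2 = N.mulVec q.rep 0 / N.mulVec q.rep 2 →
        p = q := by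
  -- The new last coordinate is taken from the family `x_2 + a x_0 + a² x_1`. At a given point this
  -- is a polynomial in `a` whose coefficients are the coordinates, so only finitely many `a` are
  -- bad.
  open Polynomial in
  obtain ⟨a, ha⟩ := exists_forall_eval_ne_zero hS
    (f := fun p => C (p.rep 2) + C (p.rep 0) * X + C (p.rep 1) * X ^ 2) fun p _ h => by
      refine p.rep_nonzero (funext fun j => ?_)
      have h0 := congrArg (Polynomial.coeff · 0) h
      have h1 := congrArg (Polynomial.coeff · 1) h
      have h2 := congrArg (Polynomial.coeff · 2) h
      simp [coeff_X, coeff_C] at h0 h1 h2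
      fin_cases j <;> simpa
  set l : (Fin 3 → K) → K := fun v => v 2 + v 0 * a + v 1 * a ^ 2 with hl
  have ha' : ∀ p ∈ S, l p.rep ≠ 0 := fun p hp => by simpa using ha p hp
  -- The new first coordinate is `x_0 + b x_1`. If a pair of points were not separated for any `b`,
  -- their `x_0 / l` and `x_1 / l` would agree, hence also `x_2 / l`, and the points would coincide.
  open Polynomial in
  obtain ⟨b, hb⟩ := exists_forall_eval_ne_zero (hS.offDiag)
    (f := fun pq => C (pq.1.rep 0 * l pq.2.rep - pq.2.rep 0 * l pq.1.rep) +
      C (pq.1.rep 1 * l pq.2.rep - pq.2.rep 1 * l pq.1.rep) * X) fun ⟨p, q⟩ hpq h => by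
      obtain ⟨hp, hq, hne⟩ := hpq
      dsimp only at hp hq hne h
      have h0 := congrArg (Polynomial.coeff · 0) h
      have h1 := congrArg (Polynomial.coeff · 1) h
      simp [-map_sub, -map_mul, coeff_C] at h0 h1
      have h2 : p.rep 2 * l q.rep - q.rep 2 * l p.rep = 0 := by
        have e : ∀ v : Fin 3 → K, v 2 = l v - v 0 * a - v 1 * a ^ 2 := fun v => by
          rw [hl]; ring
        rw [e p.rep, e q.rep]
        linear_combination -a * h0 - a ^ 2 * h1
      apply hne
      rw [← p.mk_rep, ← q.mk_rep, Projectivization.mk_eq_mk_iff']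
      refine ⟨l p.rep / l q.rep, funext fun j => ?_⟩
      have hq' := ha' q hq
      rw [Pi.smul_apply, smul_eq_mul, div_mul_eq_mul_div, div_eq_iff hq']
      have hall : ∀ j, p.rep j * l q.rep - q.rep j * l p.rep = 0 := fun j => by
        fin_cases j <;> assumption
      linear_combination -hall j
  have e0 : ∀ v : Fin 3 → K, (!![1, b, 0; 0, 1, 0; a, a ^ 2, 1]).mulVec v 0 = v 0 + b * v 1 :=
    fun v => by simp [Matrix.mulVec, dotProduct, Fin.sum_univ_three]
  have e2 : ∀ v : Fin 3 → K, (!![1, b, 0; 0, 1, 0; a, a ^ 2, 1]).mulVec v 2 = l v :=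
    fun v => by simp [Matrix.mulVec, dotProduct, Fin.sum_univ_three, hl]; ring
  refine ⟨!![1, b, 0; 0, 1, 0; a, a ^ 2, 1], ?_, fun p hp => ?_, fun p hp q hq h => ?_⟩
  · rw [Matrix.isUnit_iff_isUnit_det]
    simp [Matrix.det_fin_three]
  · rw [e2]
    exact ha' p hp
  · by_contra hne
    apply hb (p, q) ⟨hp, hq, hne⟩
    rw [e0, e0, e2, e2, div_eq_div_iff (ha' p hp) (ha' q hq)] at h
    simp only [Polynomial.eval_add, Polynomial.eval_mul, Polynomial.eval_C, Polynomial.eval_X]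
    linear_combination h

theorem ncard_criticalLocus_le_seven [IsAlgClosed K] [CharP K 2] {B : MvPolynomial (Fin 3) K}
    (hB : B.IsHomogeneous 4) (hfin : (criticalLocus B).Finite) : (criticalLocus B).ncard ≤ 7 := by
  have : Infinite K := IsAlgClosed.instInfinite
  obtain ⟨N, hN, h2, hsep⟩ := exists_separating hfin
  obtain ⟨M, hNM, hMN⟩ := isUnit_iff_exists.mp hN
  have hM : IsUnit M := isUnit_iff_exists.mpr ⟨N, hMN, hNM⟩
  have hinj : Function.Injective M.mulVecLin := Matrix.mulVec_injective_of_isUnit hM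
  let f : ℙ K (Fin 3 → K) → ℙ K (Fin 3 → K) := Projectivization.map M.mulVecLin hinj
  have hf : Function.Injective f := Projectivization.map_injective _ hinj
  have hpre : criticalLocus (substitute M B) = f ⁻¹' criticalLocus B := by
    ext p
    induction p using Projectivization.ind with | h v hv =>
    exact mk_mem_criticalLocus_substitute_iff hB hM hv _
  have hsurj : Function.Surjective f := by
    intro q
    induction q using Projectivization.ind with | h v hv =>
    have hv' : N.mulVec v ≠ 0 := fun h => hv <| by
      simpa [Matrix.mulVec_mulVec, hMN] using congrArg M.mulVec h
    refine ⟨Projectivization.mk K (N.mulVec v) hv', ?_⟩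
    simp [f, Projectivization.map_mk, Matrix.mulVec_mulVec, hMN]
  -- Chosen representatives are compatible with `f` only up to a scalar, which cancels in the
  -- coordinate ratios.
  have hrep : ∀ p, ∃ s : K, s ≠ 0 ∧ N.mulVec (f p).rep = s • p.rep := by
    intro p
    have hp : f p = Projectivization.mk K (M.mulVec p.rep)
        (fun h => p.rep_nonzero (hinj (by simpa using h))) := by
      conv_lhs => rw [← p.mk_rep]
      rfl
    obtain ⟨s, hs⟩ := Projectivization.exists_smul_eq_mk_rep K (M.mulVec p.rep)
        (fun h => p.rep_nonzero (hinj (by simpa using h)))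
    refine ⟨s, s.ne_zero, ?_⟩
    rw [hp, ← hs, Units.smul_def, Matrix.mulVec_smul, Matrix.mulVec_mulVec, hNM, Matrix.one_mulVec]
  rw [← Set.ncard_preimage_of_injective_subset_range hf
    (hsurj.range_eq ▸ Set.subset_univ (criticalLocus B)), ← hpre]
  refine ncard_le_seven_of_injOn (isHomogeneous_substitute M hB) ?_ ?_ ?_
  · rw [hpre]
    exact hfin.preimage hf.injOn
  · intro p hp h0
    rw [hpre] at hp
    obtain ⟨s, -, hs⟩ := hrep p
    exact h2 _ hp (by simp [hs, h0])
  · intro p hp q hq hpq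
    rw [hpre] at hp hq
    obtain ⟨s, hs0, hs⟩ := hrep p
    obtain ⟨r, hr0, hr⟩ := hrep q
    refine hf (hsep _ hp _ hq ?_)
    simpa [hs, hr, mul_div_mul_left, hs0, hr0, chartVector] using hpq

/-- One chart gives at least seven points, but others could lie outside it; the general upper bound
excludes this. -/
theorem hasExactlyReducedCriticalPoints_of_isGeneric [IsAlgClosed K] [CharP K 2]
    {B : MvPolynomial (Fin 3) K} (hB : B.IsHomogeneous 4) (h : ∀ i, (gradCoeffs B).IsGeneric i) :
    HasExactlyReducedCriticalPoints B 7 :=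
  have hfin := finite_of_isGeneric hB h
  ⟨hfin, (ncard_criticalLocus_le_seven hB hfin).antisymm (seven_le_ncard_of_isGeneric hB (h 0) hfin),
    fun i => isReduced_criticalChart hB (h i)⟩

/-! ### The Klein quartic -/

section Klein

theorem kleinQuartic_eq : kleinQuartic K = ∑ i, MvPolynomial.monomial (exponent i 3 1 0) 1 := by
  have h : ∀ i : Fin 3, MvPolynomial.monomial (exponent i 3 1 0) (1 : K) =
      MvPolynomial.X i ^ 3 * MvPolynomial.X (i + 1) := fun i => by
    have he : exponent i 3 1 0 = Finsupp.single i 3 + Finsupp.single (i + 1) 1 := by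
      ext j
      fin_cases i <;> fin_cases j <;> simp [exponent]
    rw [MvPolynomial.X_pow_eq_monomial, MvPolynomial.X, MvPolynomial.monomial_mul, one_mul, he]
  simp only [h, Fin.sum_univ_three]
  rfl

variable (K) in
theorem isHomogeneous_kleinQuartic : (kleinQuartic K).IsHomogeneous 4 := by
  rw [kleinQuartic_eq]
  exact MvPolynomial.IsHomogeneous.sum _ _ _ fun i _ =>
    MvPolynomial.isHomogeneous_monomial _ (degree_exponent i 3 1 0)

variable (K) in
theorem gradCoeffs_kleinQuartic : gradCoeffs (kleinQuartic K) = ⟨1, 0, 0⟩ := by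
  have hne : ∀ i j : Fin 3, exponent i 3 1 0 ≠ exponent j 3 0 1 ∧
      exponent i 3 1 0 ≠ exponent j 2 1 1 ∧ (exponent i 3 1 0 = exponent j 3 1 0 ↔ i = j) := by
    simp only [exponent, ne_eq, EmbeddingLike.apply_eq_iff_eq]
    decide
  rw [kleinQuartic_eq]
  simp only [gradCoeffs, GradCoeffs.ofVector, quarticCoeffs, MvPolynomial.coeff_sum,
    MvPolynomial.coeff_monomial, hne]
  simp
  exact ⟨rfl, rfl⟩

open Polynomial in
theorem isGeneric_kleinQuartic [CharP K 2] (i : Fin 3) :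
    (gradCoeffs (kleinQuartic K)).IsGeneric i := by
  have hd : derivative (X ^ 7 + 1 : K[X]) = X ^ 6 := by
    have h7 : (7 : K[X]) = 1 := by linear_combination 3 * CharTwo.two_eq_zero (R := K[X])
    rw [derivative_add, derivative_one, derivative_X_pow, Nat.cast_ofNat, C_ofNat, h7]
    ring
  rw [gradCoeffs_kleinQuartic]
  have hp : (⟨1, 0, 0⟩ : GradCoeffs K).eliminant i = X ^ 7 + 1 := by
    simp [GradCoeffs.eliminant, GradCoeffs.numer, GradCoeffs.denom, GradCoeffs.quadCoeff,
      GradCoeffs.quadConst]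
    ring
  have hq : (⟨1, 0, 0⟩ : GradCoeffs K).discriminating i = X ^ 8 := by
    simp [GradCoeffs.discriminating, hp, hd, GradCoeffs.denom, GradCoeffs.quadCoeff]
    ring
  rw [GradCoeffs.IsGeneric, hp, hq]
  -- Bézout identity `(1 - X⁷)(X⁷ + 1) + X⁶ · X⁸ = 1`.
  exact ⟨by simp [coeff_one], 1 - X ^ 7, X ^ 6, by ring⟩

theorem criticalLocus_kleinQuartic [CharP K 2] :
    criticalLocus (kleinQuartic K) = {p | ∃ ε : K, ε ^ 7 = 1 ∧ p = kleinPoint ε} := by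
  have h2 : (2 : K) = 0 := CharTwo.two_eq_zero
  ext p
  induction p using Projectivization.ind with | h v hv =>
  rw [mk_mem_criticalLocus_iff_grad (isHomogeneous_kleinQuartic K), gradCoeffs_kleinQuartic,
    Fin.forall_fin_succ, Fin.forall_fin_succ, Fin.forall_fin_one]
  have hi : (1 : Fin 3) + 1 = 2 ∧ (1 : Fin 3) + 2 = 0 ∧ (2 : Fin 3) + 1 = 0 ∧
    (2 : Fin 3) + 2 = 1 := by decide
  simp only [GradCoeffs.grad, Fin.succ_zero_eq_one, Fin.succ_one_eq_two, zero_add, hi, Pi.one_apply,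
    Pi.zero_apply, one_mul, zero_mul, add_zero, kleinPoint, Set.mem_ofPred_eq,
    Projectivization.mk_eq_mk_iff']
  constructor
  · rintro ⟨e0, e1, e2⟩
    have h0 : v 0 ≠ 0 := by
      intro h0
      have hv2 : v 2 = 0 := by simpa [h0] using e0
      have hv1 : v 1 = 0 := by simpa [h0] using e2
      exact hv (funext fun j => by fin_cases j <;> assumption)
    obtain ⟨y, hy⟩ : ∃ y, v 1 = v 0 * y := ⟨v 1 / v 0, by field_simp⟩
    obtain ⟨z, hz⟩ : ∃ z, v 2 = v 0 * z := ⟨v 2 / v 0, by field_simp⟩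
    -- The equations are solved most easily in terms of `z`: `y = z³` and `z⁷ = 1`. Then `y⁵ = z¹⁵ =
    -- z` gives back the parametrisation by `ε = y`.
    have hyz : y = z ^ 3 := by
      apply mul_left_cancel₀ (pow_ne_zero 3 h0)
      rw [hy, hz] at e0
      linear_combination e0 - v 0 ^ 3 * z ^ 3 * h2
    have hz7 : z ^ 7 = 1 := by
      apply mul_left_cancel₀ (pow_ne_zero 3 h0)
      rw [hy, hz, hyz] at e1
      linear_combination e1 - v 0 ^ 3 * h2
    refine ⟨y, by rw [hyz, ← pow_mul, mul_comm, pow_mul, hz7, one_pow], v 0, funext fun j => ?_⟩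
    have hy5 : v 2 = v 0 * y ^ 5 := by
      rw [hz, hyz]
      linear_combination -v 0 * z * (z ^ 7 + 1) * hz7
    fin_cases j
    · simp
    · simp [hy]
    · simp [hy5]
  · rintro ⟨ε, hε, a, rfl⟩
    simp only [Pi.smul_apply, smul_eq_mul, Matrix.cons_val]
    refine ⟨?_, ?_, ?_⟩
    · linear_combination a ^ 3 * ε * (ε ^ 7 + 1) * hε + a ^ 3 * ε * h2
    · linear_combination a ^ 3 * hε + a ^ 3 * h2
    · linear_combination a ^ 3 * ε ^ 3 * hε + a ^ 3 * ε ^ 3 * h2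

end Klein

/-! ### The general quartic -/

theorem isZariskiOpen_setOf_eval_ne_zero {ι : Type*} (F : MvPolynomial ι K) :
    IsZariskiOpen {c : ι → K | MvPolynomial.eval c F ≠ 0} := by
  refine ⟨Ideal.span {F}, ?_⟩
  rw [MvPolynomial.zeroLocus_span]
  ext c
  simp

theorem holdsForGeneralQuartic [IsAlgClosed K] [CharP K 2] :
    HoldsForGeneralQuartic
      (fun B : MvPolynomial (Fin 3) K => HasExactlyReducedCriticalPoints B 7) := by
  -- The genericity of the universal quartic, whose coefficients are indeterminates; evaluating `F`
  -- at a coefficient vector specialises it.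
  let F : MvPolynomial QuarticExponent K :=
    ∏ i, (GradCoeffs.ofVector MvPolynomial.X).genericity i
  have hF : ∀ c, MvPolynomial.eval c F ≠ 0 ↔ ∀ i, (GradCoeffs.ofVector c).IsGeneric i := by
    intro c
    have hc : (GradCoeffs.ofVector MvPolynomial.X).map (MvPolynomial.eval c) =
        GradCoeffs.ofVector c := by
      simp [GradCoeffs.ofVector, GradCoeffs.map]
    simp only [F, map_prod, Finset.prod_ne_zero_iff, Finset.mem_univ, true_imp_iff,
      ← GradCoeffs.genericity_map, hc, GradCoeffs.genericity_ne_zero_iff]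
  exact ⟨_, isZariskiOpen_setOf_eval_ne_zero F,
    ⟨quarticCoeffs (kleinQuartic K), (hF _).mpr isGeneric_kleinQuartic⟩,
    fun B hB hU => hasExactlyReducedCriticalPoints_of_isGeneric hB ((hF _).mp hU)⟩

end CharTwoQuartic

theorem mainTheorem4 (K : Type*) [Field K] [IsAlgClosed K] [CharP K 2] :
    (∀ B : MvPolynomial (Fin 3) K, B.IsHomogeneous 4 →
      (CharTwoQuartic.criticalLocus B).Finite → (CharTwoQuartic.criticalLocus B).ncard ≤ 7) ∧
    CharTwoQuartic.HoldsForGeneralQuartic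
      (fun B : MvPolynomial (Fin 3) K => CharTwoQuartic.HasExactlyReducedCriticalPoints B 7) ∧
    CharTwoQuartic.criticalLocus (CharTwoQuartic.kleinQuartic K) =
      {p | ∃ ε : K, ε ^ 7 = 1 ∧ p = CharTwoQuartic.kleinPoint ε} ∧
    CharTwoQuartic.HasExactlyReducedCriticalPoints (CharTwoQuartic.kleinQuartic K) 7 :=
  ⟨fun _ hB => CharTwoQuartic.ncard_criticalLocus_le_seven hB,
    CharTwoQuartic.holdsForGeneralQuartic, CharTwoQuartic.criticalLocus_kleinQuartic,
    CharTwoQuartic.hasExactlyReducedCriticalPoints_of_isGeneric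
      (CharTwoQuartic.isHomogeneous_kleinQuartic K) CharTwoQuartic.isGeneric_kleinQuartic⟩
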